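/- Let $R$ be an elementary divisor ring, i.e. a commutative unital ring such that every (rectangular) matrix over $R$ is equivalent to a diagonal matrix: for every $m\times k$ matrix $A$ over $R$ there are invertible matrices $P$ and $Q$ over $R$, of sizes $m$ and $k$, such that $PAQ$ is diagonal. Let $n\ge 2$ and let $\mathbb{M}_n(R)$ be the ring of all $n\times n$ matrices over $R$. Then every idempotent $E=E^2\in\mathbb{M}_n(R)$ has (left) unit stable range one in $S=\mathbb{M}_n(R)$: for every $B\in S$ with $SE+SB=S$ there is a unit $U\in S$ such that $E+UB$ is a unit of $S$. -/

import Mathlib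

/-- A commutative ring `R` is an elementary divisor ring if every (rectangular) matrix `A` over
`R` is equivalent to a diagonal matrix: there are invertible `P`, `Q` such that all entries of
`P * A * Q` off the main diagonal vanish. -/
def IsElementaryDivisorRing (R : Type*) [CommRing R] : Prop :=
  ∀ (m n : ℕ) (A : Matrix (Fin m) (Fin n) R),
    ∃ (P : Matrix (Fin m) (Fin m) R) (Q : Matrix (Fin n) (Fin n) R),
      IsUnit P ∧ IsUnit Q ∧
        ∀ (i : Fin m) (j : Fin n), (i : ℕ) ≠ (j : ℕ) → (P * A * Q) i j = 0

/-- An element `a` of a (not necessarily commutative) ring `S` has (left) unit stable range one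
if, whenever `S a + S b = S`, there is a unit `u` of `S` such that `a + u b` is a unit.
For a noncommutative ring, `Ideal.span {a}` is the left ideal `S a`. -/
def HasUnitStableRangeOne {S : Type*} [Ring S] (a : S) : Prop :=
  ∀ b : S, Ideal.span {a} ⊔ Ideal.span {b} = ⊤ → ∃ u : S, IsUnit u ∧ IsUnit (a + u * b)

/-! Solvability of the problem for the pair `A`, `B` survives replacing it by `P * A * Q`, `V * B *
Q` with `P`, `Q`, `V` units. Diagonalization turns `E` into a diagonal of idempotents, and splitting
`R` along these makes every entry 0 or 1, so `E` becomes `diag(0, 1)` in blocks. The relation `C * E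
+ D * B = 1` makes the first block of columns of `B` left invertible, and further operations bring
`B` to `diag(1, b)` while keeping `E` (`unitCompletes_fromBlocks`). For two diagonal matrices an
explicit unit exists: a cyclic permutation matrix plus a diagonal one, invertible as soon as a
suitable diagonal entry vanishes. -/

open Matrix

/-- Some unit `U` makes `A + U * B` a unit. -/
def UnitCompletes {R ι : Type*} [CommRing R] [Fintype ι] [DecidableEq ι]
    (A B : Matrix ι ι R) : Prop :=
  ∃ U : Matrix ι ι R, IsUnit U ∧ IsUnit (A + U * B)

/-! ### Invariance under equivalence and reindexing. -/

namespace UnitCompletes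

variable {R ι : Type*} [CommRing R] [Fintype ι] [DecidableEq ι] {A B : Matrix ι ι R}

theorem of_left (V : Matrix ι ι R) (hV : IsUnit V) (h : IsUnit (V * A + B)) :
    UnitCompletes A B := by
  obtain ⟨v, rfl⟩ := hV
  refine ⟨↑v⁻¹, v⁻¹.isUnit, ?_⟩
  have : A + v⁻¹.val * B = v⁻¹.val * (v.val * A + B) := by
    rw [mul_add, ← mul_assoc, Units.inv_mul, one_mul]
  rw [this]
  exact v⁻¹.isUnit.mul h

theorem of_equiv {P Q V : Matrix ι ι R} (hP : IsUnit P) (hQ : IsUnit Q) (hV : IsUnit V)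
    (h : UnitCompletes (P * A * Q) (V * B * Q)) : UnitCompletes A B := by
  obtain ⟨U, hU, h⟩ := h
  obtain ⟨p, rfl⟩ := hP
  obtain ⟨q, rfl⟩ := hQ
  refine ⟨p⁻¹.val * U * V, (p⁻¹.isUnit.mul hU).mul hV, ?_⟩
  have : A + p⁻¹.val * U * V * B = p⁻¹.val * (p.val * A * q.val + U * (V * B * q.val)) * q⁻¹.val := by
    simp only [mul_add, add_mul, ← mul_assoc, Units.inv_mul, one_mul]
    simp only [mul_assoc, Units.mul_inv, mul_one]
  rw [this]
  exact (p⁻¹.isUnit.mul h).mul q⁻¹.isUnit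

theorem of_submatrix {κ : Type*} [Fintype κ] [DecidableEq κ] (e : κ ≃ ι)
    (h : UnitCompletes (A.submatrix e e) (B.submatrix e e)) : UnitCompletes A B := by
  obtain ⟨U, hU, h⟩ := h
  refine ⟨U.submatrix e.symm e.symm, (isUnit_submatrix_equiv _ _).2 hU, ?_⟩
  rw [← isUnit_submatrix_equiv e e]
  convert h using 1
  rw [submatrix_add, Pi.add_apply, Pi.add_apply, ← submatrix_mul_equiv _ _ e e e]
  simp

end UnitCompletes

/-! ### Splitting the ring along an idempotent. -/

section Quotient

variable {R : Type*} [CommRing R]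

theorem IsElementaryDivisorRing.of_surjective {S : Type*} [CommRing S]
    (hR : IsElementaryDivisorRing R) (f : R →+* S) (hf : Function.Surjective f) :
    IsElementaryDivisorRing S := by
  intro m n A
  choose g hg using hf
  obtain ⟨P, Q, hP, hQ, h⟩ := hR m n (A.map g)
  refine ⟨P.map f, Q.map f, hP.map f.mapMatrix, hQ.map f.mapMatrix, fun i j hij => ?_⟩
  have hA : A = (A.map g).map f := by ext; simp [hg]
  rw [hA, ← Matrix.map_mul, ← Matrix.map_mul, map_apply, h i j hij, map_zero]

/-- Since `R ≅ R/(e) × R/(1 - e)`, lifts of the two inverses glue with weights `1 - e` and `e`; the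
error terms carry the factor `e * (1 - e) = 0`. -/
theorem isUnit_of_quotient_idempotent {e : R} (he : e * e = e) {x : R}
    (h₁ : IsUnit (Ideal.Quotient.mk (Ideal.span {e}) x))
    (h₂ : IsUnit (Ideal.Quotient.mk (Ideal.span {1 - e}) x)) : IsUnit x := by
  have key : ∀ f : R, IsUnit (Ideal.Quotient.mk (Ideal.span {f}) x) →
      ∃ y z, x * y = 1 + f * z := by
    intro f h
    obtain ⟨y, hy⟩ := h.exists_right_inv
    obtain ⟨y, rfl⟩ := Ideal.Quotient.mk_surjective y
    rw [← map_mul, ← map_one (Ideal.Quotient.mk (Ideal.span {f})), Ideal.Quotient.eq,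
      Ideal.mem_span_singleton] at hy
    obtain ⟨z, hz⟩ := hy
    exact ⟨y, z, by linear_combination hz⟩
  obtain ⟨y₁, z₁, h₁⟩ := key _ h₁
  obtain ⟨y₂, z₂, h₂⟩ := key _ h₂
  refine IsUnit.of_mul_eq_one ((1 - e) * y₁ + e * y₂) ?_
  linear_combination (1 - e) * h₁ + e * h₂ - (z₁ + z₂) * he

theorem Matrix.isUnit_map_iff_isUnit_map_det {S ι : Type*} [CommRing S] [Fintype ι]
    [DecidableEq ι] (f : R →+* S) (M : Matrix ι ι R) : IsUnit (M.map f) ↔ IsUnit (f M.det) := by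
  rw [isUnit_iff_isUnit_det, ← RingHom.mapMatrix_apply, ← RingHom.map_det]

theorem UnitCompletes.of_quotient_idempotent {ι : Type*} [Fintype ι] [DecidableEq ι]
    {A B : Matrix ι ι R} {e : R} (he : e * e = e)
    (h₁ : UnitCompletes (A.map (Ideal.Quotient.mk (Ideal.span {e})))
      (B.map (Ideal.Quotient.mk (Ideal.span {e}))))
    (h₂ : UnitCompletes (A.map (Ideal.Quotient.mk (Ideal.span {1 - e})))
      (B.map (Ideal.Quotient.mk (Ideal.span {1 - e})))) : UnitCompletes A B := by
  obtain ⟨U₁, hU₁, h₁⟩ := h₁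
  obtain ⟨U₂, hU₂, h₂⟩ := h₂
  have lift : ∀ (I : Ideal R) (M : Matrix ι ι (R ⧸ I)),
      ∃ N : Matrix ι ι R, N.map (Ideal.Quotient.mk I) = M := fun I M => by
    choose g hg using (Ideal.Quotient.mk_surjective (I := I))
    exact ⟨M.map g, by ext; simp [hg]⟩
  obtain ⟨V₁, rfl⟩ := lift _ U₁
  obtain ⟨V₂, rfl⟩ := lift _ U₂
  set V : Matrix ι ι R := (1 - e) • V₁ + e • V₂
  have z₁ : Ideal.Quotient.mk (Ideal.span {e}) e = 0 :=
    Ideal.Quotient.eq_zero_iff_mem.2 (Ideal.mem_span_singleton_self e)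
  have z₂ : Ideal.Quotient.mk (Ideal.span {1 - e}) (1 - e) = 0 :=
    Ideal.Quotient.eq_zero_iff_mem.2 (Ideal.mem_span_singleton_self _)
  have z₃ : Ideal.Quotient.mk (Ideal.span {1 - e}) e = 1 := by
    rw [map_sub, map_one] at z₂
    exact (sub_eq_zero.1 z₂).symm
  have e₁ : V₁.map (Ideal.Quotient.mk (Ideal.span {e})) =
      V.map (Ideal.Quotient.mk (Ideal.span {e})) := by
    ext; simp [V, z₁]
  have e₂ : V₂.map (Ideal.Quotient.mk (Ideal.span {1 - e})) =
      V.map (Ideal.Quotient.mk (Ideal.span {1 - e})) := by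
    ext i j
    simp only [V, map_apply, Matrix.add_apply, Matrix.smul_apply, smul_eq_mul, map_add, map_mul,
      z₂, z₃, zero_mul, zero_add, one_mul]
  rw [e₁] at hU₁ h₁
  rw [e₂] at hU₂ h₂
  rw [← Matrix.map_mul, ← Matrix.map_add _ (map_add _), isUnit_map_iff_isUnit_map_det] at h₁ h₂
  rw [isUnit_map_iff_isUnit_map_det] at hU₁ hU₂
  exact ⟨V, (isUnit_iff_isUnit_det _).2 (isUnit_of_quotient_idempotent he hU₁ hU₂),
    (isUnit_iff_isUnit_det _).2 (isUnit_of_quotient_idempotent he h₁ h₂)⟩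

end Quotient

/-! ### Diagonal pairs, by cyclic permutation matrices. -/

section Cyclic

variable (R : Type*) [CommRing R]

/-- The cyclic permutation matrix with ones at the positions `(i, i + 1)`. -/
def cyclicMatrix (n : ℕ) : Matrix (Fin (n + 1)) (Fin (n + 1)) R :=
  Matrix.of fun i j => if i + 1 = j then 1 else 0

variable {R} {n : ℕ}

theorem cyclicMatrix_mul_transpose : cyclicMatrix R n * (cyclicMatrix R n)ᵀ = 1 := by
  ext i j
  simp [cyclicMatrix, Matrix.mul_apply, Matrix.one_apply, eq_comm]

theorem isUnit_cyclicMatrix : IsUnit (cyclicMatrix R n) :=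
  IsUnit.of_mul_eq_one _ cyclicMatrix_mul_transpose

theorem transpose_cyclicMatrix_mul : (cyclicMatrix R n)ᵀ * cyclicMatrix R n = 1 :=
  mul_eq_one_comm.1 cyclicMatrix_mul_transpose

theorem Matrix.isUnit_one_add_of_strictLower {N : Matrix (Fin n) (Fin n) R}
    (h : ∀ i j, i ≤ j → N i j = 0) : IsUnit (1 + N) := by
  rw [isUnit_iff_isUnit_det, det_of_isLowerTriangular]
  · simp [h _ _ le_rfl]
  · intro i j hij
    have hij : i < j := hij
    simp [h _ _ hij.le, Matrix.one_apply_ne hij.ne]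

theorem Fin.lt_add_one_of_ne_zero {j : Fin (n + 1)} (h : j + 1 ≠ 0) : j < j + 1 := by
  rcases eq_or_ne j (Fin.last n) with rfl | hj
  · simp at h
  · exact Fin.lt_add_one_iff.2 (Fin.lt_last_iff_ne_last.2 hj)

/-- After factoring out the permutation, `d` times the transpose is strictly lower triangular except
for the wrap-around corner, whose entry is `d 0`. In the next lemma, factoring on the other side
puts the last entry of `d` in that corner. -/
theorem isUnit_cyclicMatrix_add_diagonal_of_zero {d : Fin (n + 1) → R} (h : d 0 = 0) :
    IsUnit (cyclicMatrix R n + diagonal d) := by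
  have : cyclicMatrix R n + diagonal d =
      (1 + diagonal d * (cyclicMatrix R n)ᵀ) * cyclicMatrix R n := by
    rw [add_mul, one_mul, mul_assoc, transpose_cyclicMatrix_mul, mul_one]
  rw [this]
  refine (isUnit_one_add_of_strictLower fun i j hij => ?_).mul isUnit_cyclicMatrix
  rw [diagonal_mul]
  by_cases hi : j + 1 = i
  · by_cases h0 : i = 0
    · rw [h0, h, zero_mul]
    · subst hi
      exact absurd hij (not_le.2 (Fin.lt_add_one_of_ne_zero h0))
  · simp [cyclicMatrix, hi]

theorem isUnit_cyclicMatrix_add_diagonal_of_last {d : Fin (n + 1) → R} (h : d (Fin.last n) = 0) :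
    IsUnit (cyclicMatrix R n + diagonal d) := by
  have : cyclicMatrix R n + diagonal d =
      cyclicMatrix R n * (1 + (cyclicMatrix R n)ᵀ * diagonal d) := by
    rw [mul_add, mul_one, ← mul_assoc, cyclicMatrix_mul_transpose, one_mul]
  rw [this]
  refine isUnit_cyclicMatrix.mul (isUnit_one_add_of_strictLower fun i j hij => ?_)
  rw [mul_diagonal]
  by_cases hi : j + 1 = i
  · by_cases h0 : j = Fin.last n
    · rw [h0, h, mul_zero]
    · subst hi
      exact absurd hij (not_le.2 (Fin.lt_add_one_iff.2 (Fin.lt_last_iff_ne_last.2 h0)))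
  · simp [cyclicMatrix, hi]

theorem isUnit_one_add_cyclicMatrix_mul_diagonal {d : Fin (n + 1) → R} (h : d 0 = 0) :
    IsUnit (1 + cyclicMatrix R n * diagonal d) := by
  rw [← isUnit_transpose, transpose_add, transpose_one]
  refine isUnit_one_add_of_strictLower fun i j hij => ?_
  rw [transpose_apply, mul_diagonal]
  by_cases hi : j + 1 = i
  · by_cases h0 : i = 0
    · rw [h0, h, mul_zero]
    · subst hi
      exact absurd hij (not_le.2 (Fin.lt_add_one_of_ne_zero h0))
  · simp [cyclicMatrix, hi]

/-- Split `b` as `x` plus a vector supported at the last index. Both `x` and `x - b` then vanish at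
one end, since `0` and the last index differ in size at least two. -/
theorem unitCompletes_one_diagonal (b : Fin (n + 2) → R) :
    UnitCompletes 1 (diagonal b) := by
  set x : Fin (n + 2) → R := fun j => if j = Fin.last _ then 0 else b j
  refine UnitCompletes.of_left (-(cyclicMatrix R (n + 1) + diagonal x))
    (isUnit_cyclicMatrix_add_diagonal_of_last (by simp [x])).neg ?_
  have : -(cyclicMatrix R (n + 1) + diagonal x) * 1 + diagonal b =
      -(cyclicMatrix R (n + 1) + diagonal (x - b)) := by
    rw [show diagonal (x - b) = diagonal x - diagonal b from (diagonal_sub x b).symm, mul_one]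
    abel
  rw [this]
  exact (isUnit_cyclicMatrix_add_diagonal_of_zero (by simp [x, Fin.ext_iff])).neg

/-- The hypothesis gives `(1 - b) * ε + b = 1` entrywise, so adding `diagonal (1 - b)` to the cyclic
matrix leaves a unitriangular sum: `ε 0 = 0` kills the corner. -/
theorem unitCompletes_diagonal_diagonal_of_zero {ε b : Fin (n + 1) → R} (h₀ : ε 0 = 0)
    (h : ∀ j, (ε j = 0 ∧ b j = 1) ∨ ε j = 1) :
    UnitCompletes (diagonal ε) (diagonal b) := by
  have hb : b 0 = 1 := by
    rcases h 0 with h | h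
    · exact h.2
    -- Here `0 = 1`, so the ring is trivial.
    · exact eq_of_zero_eq_one (h₀ ▸ h) _ _
  refine UnitCompletes.of_left (cyclicMatrix R n + diagonal (1 - b))
    (isUnit_cyclicMatrix_add_diagonal_of_zero (by simp [hb])) ?_
  have hd : (fun i => (1 - b) i * ε i + b i) = 1 := by
    ext j
    rcases h j with ⟨h, h'⟩ | h <;> simp [*]
  have : (cyclicMatrix R n + diagonal (1 - b)) * diagonal ε + diagonal b =
      1 + cyclicMatrix R n * diagonal ε := by
    rw [add_mul, diagonal_mul_diagonal, add_assoc, diagonal_add, hd, add_comm (cyclicMatrix R n * _),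
      show diagonal (1 : Fin (n + 1) → R) = 1 from diagonal_one]
  rw [this]
  exact isUnit_one_add_cyclicMatrix_mul_diagonal h₀

end Cyclic

/-! ### Block normal form for a 0-1 diagonal matrix. -/

section Blocks

variable {R : Type*} [CommRing R]

/-- A left invertible block of columns over an elementary divisor ring is completed to an
invertible matrix. -/
theorem IsElementaryDivisorRing.exists_isUnit_mul_eq_fromRows (hR : IsElementaryDivisorRing R)
    {k m : ℕ} (B : Matrix (Fin k ⊕ Fin m) (Fin k) R) (L : Matrix (Fin k) (Fin k ⊕ Fin m) R)
    (hL : L * B = 1) :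
    ∃ V : Matrix (Fin k ⊕ Fin m) (Fin k ⊕ Fin m) R, IsUnit V ∧ V * B = fromRows 1 0 := by
  obtain ⟨P, Q, hP, hQ, h⟩ := hR _ _ (B.submatrix finSumFinEquiv.symm id)
  set P' := P.submatrix (finSumFinEquiv (m := k) (n := m)) finSumFinEquiv with hP'
  have hPu : IsUnit P' := (isUnit_submatrix_equiv _ _).2 hP
  have hPB : P' * B * Q = (P * B.submatrix finSumFinEquiv.symm id * Q).submatrix
      finSumFinEquiv id := by
    rw [← submatrix_mul_equiv _ _ _ (Equiv.refl _), ← submatrix_mul_equiv _ _ _ finSumFinEquiv]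
    simp [hP']
  obtain ⟨d, hd⟩ : ∃ d : Fin k → R, P' * B * Q = fromRows (diagonal d) 0 := by
    refine ⟨fun i => (P' * B * Q) (Sum.inl i) i, ?_⟩
    ext (i | i) j
    · by_cases hij : i = j
      · subst hij; simp
      · rw [hPB, submatrix_apply, h _ _ (by simpa [Fin.ext_iff] using hij)]
        simp [hij]
    · rw [hPB, submatrix_apply, h _ _ (by simp; omega)]
      simp
  obtain ⟨p, hp⟩ := hPu
  obtain ⟨q, rfl⟩ := hQ
  set Z : Matrix (Fin k) (Fin k ⊕ Fin m) R := q⁻¹.val * L * p⁻¹.val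
  -- Left invertibility of `B` passes to its diagonal form, so the square block `diagonal d` is
  -- invertible and can be normalized to 1.
  have hZ : Z.toCols₁ * diagonal d = 1 := by
    have : Z * (P' * B * q.val) = 1 := by
      have h1 : p⁻¹.val * P' = 1 := by rw [← hp]; exact p.inv_mul
      calc Z * (P' * B * q.val)
          = q⁻¹.val * (L * ((p⁻¹.val * P') * B)) *
              q.val := by simp only [Z, Matrix.mul_assoc]
        _ = 1 := by rw [h1, Matrix.one_mul, hL, Matrix.mul_one]; exact q.inv_mul
    rw [hd, ← fromCols_toCols Z, fromCols_mul_fromRows] at this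
    simpa using this
  have hBq : P' * B = fromRows (diagonal d * q⁻¹.val) 0 := by
    have : P' * B = P' * B * q.val * q⁻¹.val := by
      rw [Matrix.mul_assoc, Units.mul_inv, Matrix.mul_one]
    rw [this, hd, fromRows_mul, Matrix.zero_mul]
  refine ⟨fromBlocks (q.val * Z.toCols₁) 0 0 1 * P',
    (isUnit_fromBlocks_zero₂₁.2 ⟨q.isUnit.mul (.of_mul_eq_one _ hZ), isUnit_one⟩).mul
      (hp ▸ p.isUnit), ?_⟩
  rw [Matrix.mul_assoc, hBq, fromBlocks_mul_fromRows]
  have : q.val * Z.toCols₁ * (diagonal d * q⁻¹.val) = 1 := by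
    rw [mul_assoc, ← mul_assoc Z.toCols₁, hZ, one_mul, Units.mul_inv]
  rw [this]
  simp only [Matrix.mul_zero, Matrix.zero_mul, add_zero]

theorem IsElementaryDivisorRing.exists_diagonal (hR : IsElementaryDivisorRing R) {n : ℕ}
    (A : Matrix (Fin n) (Fin n) R) : ∃ P Q : Matrix (Fin n) (Fin n) R, IsUnit P ∧ IsUnit Q ∧
      ∃ d : Fin n → R, P * A * Q = diagonal d := by
  obtain ⟨P, Q, hP, hQ, h⟩ := hR n n A
  refine ⟨P, Q, hP, hQ, fun i => (P * A * Q) i i, ?_⟩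
  ext i j
  by_cases hij : i = j
  · subst hij; simp
  · rw [h i j (by simpa [Fin.ext_iff] using hij), diagonal_apply_ne _ hij]

theorem unitCompletes_fromBlocks_diagonal {k m : ℕ} (hkm : 2 ≤ k + m) (b : Fin m → R) :
    UnitCompletes (fromBlocks 0 0 0 1 : Matrix (Fin k ⊕ Fin m) (Fin k ⊕ Fin m) R)
      (fromBlocks 1 0 0 (diagonal b)) := by
  have h1 : (fromBlocks 0 0 0 1 : Matrix (Fin k ⊕ Fin m) (Fin k ⊕ Fin m) R) =
      diagonal (Sum.elim 0 1) := by
    rw [← fromBlocks_diagonal]; simp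
  have h2 : (fromBlocks 1 0 0 (diagonal b) : Matrix (Fin k ⊕ Fin m) (Fin k ⊕ Fin m) R) =
      diagonal (Sum.elim 1 b) := by
    rw [← fromBlocks_diagonal]; simp
  rw [h1, h2]
  rcases Nat.eq_zero_or_pos k with rfl | hk
  · obtain ⟨m, rfl⟩ : ∃ l, m = l + 2 := ⟨m - 2, by omega⟩
    refine .of_submatrix (Equiv.emptySum (Fin 0) (Fin (m + 2))).symm ?_
    rw [submatrix_diagonal_equiv, submatrix_diagonal_equiv]
    convert unitCompletes_one_diagonal b using 1
    · rw [← diagonal_one]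
      congr 1
    · congr 1
  · obtain ⟨l, hl⟩ : ∃ l, l + 1 = k + m := ⟨k + m - 1, by omega⟩
    let e : Fin (l + 1) ≃ Fin k ⊕ Fin m := (finCongr hl).trans finSumFinEquiv.symm
    have he : e 0 = Sum.inl ⟨0, hk⟩ := by
      rw [← Equiv.eq_symm_apply]
      simp [e]
    refine .of_submatrix e ?_
    rw [submatrix_diagonal_equiv, submatrix_diagonal_equiv]
    refine unitCompletes_diagonal_diagonal_of_zero (by simp [he]) fun j => ?_
    rcases hj : e j with i | i <;> simp [hj]

theorem IsElementaryDivisorRing.unitCompletes_fromBlocks (hR : IsElementaryDivisorRing R)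
    {k m : ℕ} (hkm : 2 ≤ k + m) (B C D : Matrix (Fin k ⊕ Fin m) (Fin k ⊕ Fin m) R)
    (h : C * fromBlocks 0 0 0 1 + D * B = 1) : UnitCompletes (fromBlocks 0 0 0 1) B := by
  -- The first `k` columns of `C * fromBlocks 0 0 0 1` vanish, so the upper left block of `h`
  -- involves only `D` and `B`.
  have hL : D.toRows₁ * B.toCols₁ = 1 := by
    ext i j
    have := congr_fun₂ h (Sum.inl i) (Sum.inl j)
    rw [← fromBlocks_toBlocks C, fromBlocks_multiply] at this
    simpa [Matrix.mul_apply, Matrix.one_apply] using this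
  obtain ⟨V, hV, hVB⟩ := hR.exists_isUnit_mul_eq_fromRows _ _ hL
  obtain ⟨c, a, hca⟩ : ∃ c a, V * B = fromBlocks 1 c 0 a := by
    refine ⟨(V * B).toBlocks₁₂, (V * B).toBlocks₂₂, ?_⟩
    conv_lhs => rw [← fromBlocks_toBlocks (V * B)]
    congr 1 <;> ext i j
    · exact congr_fun₂ hVB (Sum.inl i) j
    · exact congr_fun₂ hVB (Sum.inr i) j
  obtain ⟨P, Q, hP, ⟨q, rfl⟩, d, hd⟩ := hR.exists_diagonal a
  -- The column operation `Q` clears `c` and completes the diagonalization of `a`; the factor `q⁻¹`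
  -- in `P` restores `fromBlocks 0 0 0 1`.
  refine .of_equiv
    (P := fromBlocks 1 0 0 q⁻¹.val)
    (Q := fromBlocks 1 (-(c * q.val)) 0 q.val)
    (V := fromBlocks 1 0 0 P * V)
    (isUnit_fromBlocks_zero₂₁.2 ⟨isUnit_one, q⁻¹.isUnit⟩)
    (isUnit_fromBlocks_zero₂₁.2 ⟨isUnit_one, q.isUnit⟩)
    ((isUnit_fromBlocks_zero₂₁.2 ⟨isUnit_one, hP⟩).mul hV) ?_
  rw [mul_assoc _ V B, hca]
  simp only [fromBlocks_multiply, Matrix.mul_zero, Matrix.zero_mul, Matrix.one_mul,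
    Matrix.mul_one, add_zero, zero_add, Units.inv_mul, hd]
  rw [neg_add_cancel]
  exact unitCompletes_fromBlocks_diagonal hkm d

end Blocks

/-! ### From 0-1 diagonals to arbitrary idempotents. -/

theorem IsElementaryDivisorRing.unitCompletes_diagonal_zero_one {R : Type*} [CommRing R]
    (hR : IsElementaryDivisorRing R) {n : ℕ} (hn : 2 ≤ n) {ε : Fin n → R}
    (hε : ∀ i, ε i = 0 ∨ ε i = 1) (B C D : Matrix (Fin n) (Fin n) R)
    (h : C * diagonal ε + D * B = 1) : UnitCompletes (diagonal ε) B := by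
  classical
  let e : Fin (Fintype.card {i // ε i = 0}) ⊕ Fin (Fintype.card {i // ¬ ε i = 0}) ≃ Fin n :=
    (Equiv.sumCongr (Fintype.equivFin _).symm (Fintype.equivFin _).symm).trans
      (Equiv.sumCompl fun i => ε i = 0)
  have hA : (diagonal ε).submatrix e e = fromBlocks 0 0 0 1 := by
    rw [submatrix_diagonal_equiv, ← diagonal_zero, ← diagonal_one, fromBlocks_diagonal]
    congr 1
    ext (i | i)
    · simpa [e] using ((Fintype.equivFin {i // ε i = 0}).symm i).2
    · simpa [e] using (hε _).resolve_left ((Fintype.equivFin {i // ¬ ε i = 0}).symm i).2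
  refine .of_submatrix e ?_
  rw [hA]
  refine hR.unitCompletes_fromBlocks ?_ _ (C.submatrix e e) (D.submatrix e e) ?_
  · have := Fintype.card_congr e
    rw [Fintype.card_sum] at this
    simp only [Fintype.card_fin] at this
    omega
  · rw [← hA, submatrix_mul_equiv, submatrix_mul_equiv, ← Pi.add_apply, ← Pi.add_apply,
      ← submatrix_add, h]
    simp

/-- Induction on a set `s` containing all indices where `ε` may differ from 0 and 1. Passing to the
quotients by `ε a` and `1 - ε a` settles the entry at `a`; the ring changes, so `R` is quantified
inside the induction. -/
theorem IsElementaryDivisorRing.unitCompletes_diagonal_idempotent {n : ℕ} (hn : 2 ≤ n)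
    (s : Finset (Fin n)) : ∀ {R : Type*} [CommRing R] (_ : IsElementaryDivisorRing R)
    {ε : Fin n → R} (_ : ∀ i, ε i * ε i = ε i) (_ : ∀ i ∉ s, ε i = 0 ∨ ε i = 1)
    (B C D : Matrix (Fin n) (Fin n) R) (_ : C * diagonal ε + D * B = 1),
    UnitCompletes (diagonal ε) B := by
  induction s using Finset.induction with
  | empty =>
    intro R _ hR ε _ hs B C D h
    exact hR.unitCompletes_diagonal_zero_one hn (fun i => hs i (by simp)) B C D h
  | insert a s _ ih =>
    intro R _ hR ε hε hs B C D h
    have key : ∀ I : Ideal R, (Ideal.Quotient.mk I (ε a) = 0 ∨ Ideal.Quotient.mk I (ε a) = 1) →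
        UnitCompletes ((diagonal ε).map (Ideal.Quotient.mk I))
          (B.map (Ideal.Quotient.mk I)) := by
      intro I hI
      have hm := congr_arg (fun M => M.map (Ideal.Quotient.mk I)) h
      simp only [Matrix.map_add _ (map_add _), Matrix.map_mul,
        Matrix.map_one _ (map_zero _) (map_one _)] at hm
      rw [diagonal_map (map_zero _)] at hm ⊢
      refine ih (hR.of_surjective _ Ideal.Quotient.mk_surjective) (fun i => ?_)
        (fun i hi => ?_) _ _ _ hm
      · simp [← map_mul, hε]
      · by_cases hia : i = a
        · subst hia; exact hI
        · rcases hs i (by simp [hia, hi]) with h0 | h0 <;> simp [h0]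
    refine .of_quotient_idempotent (hε a) (key _ (.inl ?_)) (key _ (.inr ?_))
    · exact Ideal.Quotient.eq_zero_iff_mem.2 (Ideal.mem_span_singleton_self _)
    · rw [← map_one (Ideal.Quotient.mk _), eq_comm, Ideal.Quotient.eq]
      exact Ideal.mem_span_singleton_self _

/-- A matrix equivalent to an idempotent is von Neumann regular, with inner inverse `X = q⁻¹ * p⁻¹`.
Hence each `d i` is regular in `R`, and a regular element of a commutative ring is a unit times an
idempotent. -/
theorem IsElementaryDivisorRing.exists_diagonal_idempotent {R : Type*} [CommRing R]
    (hR : IsElementaryDivisorRing R) {n : ℕ} {E : Matrix (Fin n) (Fin n) R}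
    (hE : IsIdempotentElem E) : ∃ P Q : Matrix (Fin n) (Fin n) R, IsUnit P ∧ IsUnit Q ∧
      ∃ ε : Fin n → R, (∀ i, ε i * ε i = ε i) ∧ P * E * Q = diagonal ε := by
  obtain ⟨P, Q, ⟨p, rfl⟩, ⟨q, rfl⟩, d, hd⟩ := hR.exists_diagonal E
  set X : Matrix (Fin n) (Fin n) R := q⁻¹.val * p⁻¹.val with hX
  have hreg : diagonal d * X * diagonal d = diagonal d := by
    rw [← hd]
    calc p.val * E * q.val * X * (p.val * E * q.val)
        = p.val * E * (q.val * q⁻¹.val) * (p⁻¹.val * p.val) * E * q.val := by simp only [hX, mul_assoc]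
      _ = p.val * (E * E) * q.val := by simp [mul_assoc]
      _ = p.val * E * q.val := by rw [hE]
  have hx : ∀ i, d i * X i i * d i = d i := fun i => by
    simpa using congr_fun₂ hreg i i
  -- With `x = X i i` and the idempotent `e = d i * x`, the unit `e * x + (1 - e)` has inverse `d i
  -- + (1 - e)` and multiplies `d i` to `e`.
  have hu : IsUnit (diagonal fun i => d i * X i i * X i i + (1 - d i * X i i)) := by
    refine IsUnit.of_mul_eq_one (diagonal fun i => d i + (1 - d i * X i i)) ?_
    rw [diagonal_mul_diagonal, ← diagonal_one]
    congr 1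
    ext i
    linear_combination (2 * X i i - X i i * X i i - 1) * hx i
  refine ⟨p, q * diagonal fun i => d i * X i i * X i i + (1 - d i * X i i), p.isUnit,
    q.isUnit.mul hu, fun i => d i * X i i, fun i => ?_, ?_⟩
  · linear_combination X i i * hx i
  · rw [← mul_assoc, hd, diagonal_mul_diagonal]
    congr 1
    ext i
    linear_combination (X i i - 1) * hx i

theorem corollary3p4 {R : Type*} [CommRing R] (hR : IsElementaryDivisorRing R)
    (n : ℕ) (hn : 2 ≤ n) (E : Matrix (Fin n) (Fin n) R) (hE : IsIdempotentElem E) :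
    HasUnitStableRangeOne E := by
  intro B hB
  have h1 : (1 : Matrix (Fin n) (Fin n) R) ∈ Ideal.span {E} ⊔ Ideal.span {B} := by
    rw [hB]; trivial
  obtain ⟨x, hx, y, hy, hxy⟩ := Submodule.mem_sup.1 h1
  obtain ⟨C, rfl⟩ := Ideal.mem_span_singleton'.1 hx
  obtain ⟨D, rfl⟩ := Ideal.mem_span_singleton'.1 hy
  obtain ⟨P, Q, ⟨p, rfl⟩, ⟨q, rfl⟩, ε, hε, h⟩ := hR.exists_diagonal_idempotent hE
  refine UnitCompletes.of_equiv (V := 1) p.isUnit q.isUnit isUnit_one ?_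
  rw [h]
  refine IsElementaryDivisorRing.unitCompletes_diagonal_idempotent hn Finset.univ hR hε (by simp)
    _ (q⁻¹.val * C * p⁻¹.val) (q⁻¹.val * D) ?_
  rw [← h]
  calc q⁻¹.val * C * p⁻¹.val * (p.val * E * q.val) + q⁻¹.val * D * (1 * B * q.val)
      = q⁻¹.val * (C * (p⁻¹.val * p.val) * E + D * B) * q.val := by
        simp only [mul_add, add_mul, mul_assoc, one_mul]
    _ = 1 := by rw [Units.inv_mul, mul_one, hxy, mul_one, Units.inv_mul]
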